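/- Let $V$ be a finite set and $\mathcal L=\{x\in[0,\infty)^V:\max_i x_i>1\}$. A random vector $Y=(Y_i)_{i\in V}$ has a multivariate Pareto distribution if it is supported on $\mathcal L$, satisfies $\mathbb P(Y\in tA)=t^{-1}\,\mathbb P(Y\in A)$ for all Borel sets $A\subset\mathcal L$ and all $t\ge 1$, and $\mathbb P(Y_m>1)>0$ for all $m\in V$. Write $Y^m$ for $Y$ conditioned on $\{Y_m>1\}$. For disjoint $A,B,C\subset V$ write $Y_A\perp_e Y_C\mid Y_B$ if, for every $m\in V$, $Y^m_A$ and $Y^m_C$ are conditionally independent given $Y^m_B$. Such a $Y$ is an extremal graphical model on a graph $G=(V,E)$ if $Y_A\perp_e Y_C\mid Y_B$ for all disjoint $A,B,C$ such that $B$ separates $A$ from $C$ in $G$. The extremal variogram rooted at $m$ is the matrix $\Gamma^{(m)}_{ij}=\operatorname{Var}(\log Y^m_i-\log Y^m_j)$; it exists if for all $i,j\in V$ the difference $\log Y_i^m-\log Y_j^m$ is almost surely well defined (with $\log 0=-\infty$, so $Y^m_i,Y^m_j>0$ almost surely) and has finite variance. Proposition. Let $Y$ be an extremal graphical model on a tree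 $T=(V,E)$ and suppose that $\Gamma^{(m)}$ exists for all $m\in V$. Then for every $m\in V$ the matrix $\Gamma^{(m)}$ defines an additive tree metric on $T$ (possibly with $\Gamma^{(m)}_{ij}=0$ for some $i\ne j$): it is non-negative, symmetric, zero on the diagonal, satisfies the triangle inequality, and $$\Gamma^{(m)}_{ij}=\sum_{(s,t)\in \mathrm{ph}(ij)}\Gamma^{(m)}_{st}\qquad\text{for all } i,j\in V,$$ where $\mathrm{ph}(ij)$ is the set of edges on the unique path from $i$ to $j$ in $T$. Moreover, for every $m\in V$ and every edge $\{s,t\}\in E$ such that $s$ lies on the path from $m$ to $t$ (the edge $(s,t)$ points away from the root $m$), $\Gamma^{(m)}_{st}=\Gamma^{(s)}_{st}$; that is, the value of $\Gamma^{(m)}$ on an edge depends on the root $m$ only through the side of the edge on which $m$ lies. -/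

import Mathlib

open MeasureTheory ProbabilityTheory
open scoped ENNReal Pointwise

noncomputable section

variable {V : Type*}

/-- The support set `𝓛 = {x ≥ 0 : ‖x‖_∞ > 1}` of multivariate Pareto distributions. -/
def paretoSupport (V : Type*) : Set (V → ℝ) :=
  {x | (∀ i, 0 ≤ x i) ∧ ∃ i, 1 < x i}

/-- `μ` is the law of a multivariate Pareto vector `Y = (Y_i)_{i ∈ V}`: a probability measure
supported on `𝓛` with `P(Y ∈ tA) = t⁻¹ P(Y ∈ A)` for all Borel `A ⊆ 𝓛` and `t ≥ 1`, for which
every event `{Y_m > 1}` has positive probability (so that conditioning on it makes sense). -/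
structure IsMultivariatePareto (μ : Measure (V → ℝ)) : Prop where
  isProbabilityMeasure : IsProbabilityMeasure μ
  supported : μ (paretoSupport V)ᶜ = 0
  homogeneous : ∀ t : ℝ, 1 ≤ t → ∀ A : Set (V → ℝ), MeasurableSet A → A ⊆ paretoSupport V →
    μ (t • A) = (ENNReal.ofReal t)⁻¹ * μ A
  exceed_pos : ∀ m : V, 0 < μ {y | 1 < y m}

/-- The law of `Y^m`, that is, of `Y` conditioned on the event `{Y_m > 1}`. -/
def exceedanceLaw (μ : Measure (V → ℝ)) (m : V) : Measure (V → ℝ) :=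
  cond μ {y | 1 < y m}

instance (μ : Measure (V → ℝ)) (m : V) : IsFiniteMeasure (exceedanceLaw μ m) := by
  unfold exceedanceLaw; infer_instance

/-- The subvector `y_A = (y_a)_{a ∈ A}`. -/
def subvector (A : Set V) (y : V → ℝ) : A → ℝ := fun a => y a

lemma measurable_subvector (A : Set V) : Measurable (subvector A) :=
  measurable_pi_lambda _ fun a => measurable_pi_apply (a : V)

/-- Extremal conditional independence `Y_A ⊥_e Y_C | Y_B`: for every root `m`, the subvectors
`Y^m_A` and `Y^m_C` are conditionally independent given `Y^m_B`. -/
def ExtremalCondIndep [Fintype V] (μ : Measure (V → ℝ)) (A B C : Set V) : Prop :=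
  ∀ m : V, CondIndepFun (MeasurableSpace.comap (subvector B) inferInstance)
    (measurable_subvector B).comap_le (subvector A) (subvector C) (exceedanceLaw μ m)

/-- `B` separates `A` and `C` in `G`: every path from `A` to `C` contains a node of `B`. -/
def GraphSeparates (G : SimpleGraph V) (A B C : Set V) : Prop :=
  ∀ a ∈ A, ∀ c ∈ C, ∀ p : G.Walk a c, p.IsPath → ∃ b ∈ p.support, b ∈ B

/-- An extremal graphical model on `G`: a multivariate Pareto distribution with the global Markov
property on `G` for extremal conditional independence. -/
structure IsExtremalGraphicalModel [Fintype V] (μ : Measure (V → ℝ)) (G : SimpleGraph V) : Prop where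
  isMultivariatePareto : IsMultivariatePareto μ
  globalMarkov : ∀ A B C : Set V, Disjoint A B → Disjoint A C → Disjoint B C →
    GraphSeparates G A B C → ExtremalCondIndep μ A B C

/-- The extremal variogram `Γ^{(m)}_{ij} = Var(log Y^m_i - log Y^m_j)` rooted at `m`.
It is meaningful under `ExtremalVariogramExists`. -/
def extremalVariogram (μ : Measure (V → ℝ)) (m i j : V) : ℝ :=
  variance (fun y => Real.log (y i) - Real.log (y j)) (exceedanceLaw μ m)

/-- `Γ^{(m)}` exists in `[0, ∞)`: for all `i, j`, the random variable `log Y^m_i - log Y^m_j` is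
almost surely well defined (both components are almost surely positive, as `log 0 = -∞`)
and has a finite second moment. -/
def ExtremalVariogramExists (μ : Measure (V → ℝ)) (m : V) : Prop :=
  ∀ i j : V, (∀ᵐ y ∂(exceedanceLaw μ m), 0 < y i ∧ 0 < y j) ∧
    MemLp (fun y => Real.log (y i) - Real.log (y j)) 2 (exceedanceLaw μ m)

/-- `D` is an additive tree (pseudo-)metric on `T`: a pseudometric for which the distance of `i`
and `j` is the sum of the lengths `D s t` of the edges `(s, t)` on the path from `i` to `j`. -/
structure IsAdditiveTreeMetric (T : SimpleGraph V) (D : V → V → ℝ) : Prop where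
  nonneg : ∀ i j, 0 ≤ D i j
  self : ∀ i, D i i = 0
  symm : ∀ i j, D i j = D j i
  triangle : ∀ i j k, D i k ≤ D i j + D j k
  additive : ∀ (i j : V) (p : T.Walk i j), p.IsPath →
    D i j = (p.darts.map fun e => D e.fst e.snd).sum

end

open Filter

/-! Let `s` separate `t` from both the root `m` and a node `a`, and put X = log Y_t - log Y_s. By
the Markov property, the conditional probability of {X ∈ B} given Y_s, Y_a and Y_m is a function
ψ(Y_s). By homogeneity, Y^m restricted to {Y_m > u} is a rescaled copy of Y^m, while X is scale
invariant; hence ψ(ux) = ψ(x) almost everywhere for each u ≥ 1, so ψ is constant. Thus X is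
independent of (Y_s, Y_a) under the root `m` (`IsExtremalGraphicalModel.indepFun_log_sub_log`). Both
claims follow. If k lies between i and j, it also lies between `m` and one of them, so the
increments over the two halves of the path are uncorrelated and variances add. If `s` lies between
`t` and `m`, conditioning further on the other exceedance changes the law of X under neither root;
the two laws then agree through {Y_m > 1, Y_s > 1}. -/

/-! ### Conditional probabilities and dilation invariance -/

/-- Conditional independence of `f` and `g` given `k` lets the conditional probability of an event
in `(k, f)` given `(k, g)` be chosen as a function of `k` alone. -/
lemma CondIndepFun.exists_conditional_probability {Ω α β γ : Type*} [MeasurableSpace Ω]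
    [StandardBorelSpace Ω] [MeasurableSpace α] [MeasurableSpace β] [MeasurableSpace γ]
    [StandardBorelSpace α] [Nonempty α] [StandardBorelSpace β] [Nonempty β]
    {ν : Measure Ω} [IsFiniteMeasure ν] {f : Ω → α} {g : Ω → β} {k : Ω → γ}
    (hf : Measurable f) (hg : Measurable g) (hk : Measurable k)
    (h : CondIndepFun (MeasurableSpace.comap k inferInstance) hk.comap_le f g ν)
    {S : Set (γ × α)} (hS : MeasurableSet S) :
    ∃ φ : γ → ℝ≥0∞, Measurable φ ∧ ∀ E : Set (γ × β), MeasurableSet E →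
      ν ({ω | (k ω, g ω) ∈ E} ∩ {ω | (k ω, f ω) ∈ S}) =
        ∫⁻ ω in {ω | (k ω, g ω) ∈ E}, φ (k ω) ∂ν := by
  have h' := (condIndepFun_iff_condDistrib_prod_ae_eq_prodMkRight hf hg hk).1 h.symm
  rw [condDistrib_ae_eq_iff_measure_eq_compProd _ hf.aemeasurable] at h'
  have hφ : Measurable fun z => condDistrib f k ν z (Prod.mk z ⁻¹' S) :=
    Kernel.measurable_kernel_prodMk_left hS
  refine ⟨_, hφ, fun E hE => ?_⟩
  have hS' : MeasurableSet {q : (γ × β) × α | q.1 ∈ E ∧ (q.1.1, q.2) ∈ S} :=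
    (measurable_fst hE).inter
      ((by fun_prop : Measurable fun q : (γ × β) × α => (q.1.1, q.2)) hS)
  have key := congrArg (fun ρ => ρ {q : (γ × β) × α | q.1 ∈ E ∧ (q.1.1, q.2) ∈ S}) h'
  rw [Measure.map_apply (by fun_prop) hS', Measure.compProd_apply hS',
    lintegral_map (Kernel.measurable_kernel_prodMk_left hS') (by fun_prop)] at key
  refine key.trans ?_
  have hE' : MeasurableSet {ω | (k ω, g ω) ∈ E} := (hk.prodMk hg) hE
  rw [← lintegral_indicator hE']
  refine lintegral_congr fun ω => ?_
  by_cases hω : (k ω, g ω) ∈ E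
  · rw [Set.indicator_of_mem (by exact hω)]
    simp [Kernel.prodMkRight_apply, Set.preimage, hω]
  · rw [Set.indicator_of_notMem (by exact hω)]
    simp [hω]

/-- A function on the half-line that is almost everywhere invariant under each dilation by a factor
`u ≥ 1` is almost everywhere constant. -/
lemma exists_ae_eq_const_of_ae_dilation_invariant {ρ : Measure ℝ} [IsFiniteMeasure ρ]
    (hpos : ∀ᵐ x ∂ρ, 0 < x) {φ : ℝ → ℝ≥0∞} (hφ : Measurable φ)
    (h : ∀ u : ℝ, 1 ≤ u → ∀ᵐ x ∂ρ, φ (u * x) = φ x) :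
    ∃ c, ∀ᵐ x ∂ρ, φ x = c := by
  have hset : MeasurableSet {q : ℝ × ℝ | φ (q.1 * q.2) = φ q.2} :=
    measurableSet_eq_fun (by fun_prop) (by fun_prop)
  have h1 : ∀ᵐ u ∂(volume.restrict (Set.Ici (1 : ℝ))), ∀ᵐ x ∂ρ, φ (u * x) = φ x :=
    (ae_restrict_iff' measurableSet_Ici).2 (Eventually.of_forall h)
  -- The exceptional null set depends on u; Fubini gives, for almost every x, invariance for almost
  -- every u ≥ 1.
  rw [Measure.ae_ae_comm hset] at h1
  rcases eq_or_ne ρ 0 with rfl | hρ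
  · exact ⟨0, by simp⟩
  have : (ae ρ).NeBot := ae_neBot.2 hρ
  obtain ⟨x₀, hx₀, hx₀pos⟩ := (h1.and hpos).exists
  refine ⟨φ x₀, ?_⟩
  filter_upwards [h1, hpos] with x hx hxpos
  rw [ae_restrict_iff' measurableSet_Ici] at hx hx₀
  have h2 : ∀ᵐ v : ℝ, x⁻¹ * v ∈ Set.Ici (1 : ℝ) → φ (x⁻¹ * v * x) = φ x :=
    (Measure.quasiMeasurePreserving_smul volume (inv_ne_zero hxpos.ne')).ae hx
  have h3 : ∀ᵐ v : ℝ, x₀⁻¹ * v ∈ Set.Ici (1 : ℝ) → φ (x₀⁻¹ * v * x₀) = φ x₀ :=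
    (Measure.quasiMeasurePreserving_smul volume (inv_ne_zero hx₀pos.ne')).ae hx₀
  -- Almost every v beyond both points is a good dilate of x and of x₀ at once, so φ x = φ v = φ x₀.
  have h4 : ∃ᵐ v : ℝ, v ∈ Set.Ioi (max x x₀) := by
    rw [frequently_ae_mem_iff]; simp
  obtain ⟨v, hv, hvx, hvx₀⟩ := (h4.and_eventually (h2.and h3)).exists
  have hv' : x < v ∧ x₀ < v := by simpa using hv
  have e1 := hvx ((one_le_inv_mul₀ hxpos).2 hv'.1.le)
  have e2 := hvx₀ ((one_le_inv_mul₀ hx₀pos).2 hv'.2.le)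
  rw [mul_comm, mul_inv_cancel_left₀ hxpos.ne'] at e1
  rw [mul_comm, mul_inv_cancel_left₀ hx₀pos.ne'] at e2
  rw [← e1, e2]

/-! ### Homogeneity of the exceedance laws -/

variable {μ : Measure (V → ℝ)}

lemma measurableSet_lt_apply (m : V) (u : ℝ) : MeasurableSet {y : V → ℝ | u < y m} :=
  measurableSet_lt measurable_const (measurable_pi_apply m)

lemma measurableSet_paretoSupport [Fintype V] : MeasurableSet (paretoSupport V) := by
  have : paretoSupport V = (⋂ i, {y | 0 ≤ y i}) ∩ ⋃ i, {y | 1 < y i} := by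
    ext y; simp [paretoSupport]
  rw [this]
  exact (MeasurableSet.iInter fun i =>
    measurableSet_le measurable_const (measurable_pi_apply i)).inter
    (MeasurableSet.iUnion fun i => measurableSet_lt_apply i 1)

lemma IsMultivariatePareto.isProbabilityMeasure_exceedanceLaw (hμ : IsMultivariatePareto μ)
    (m : V) : IsProbabilityMeasure (exceedanceLaw μ m) :=
  have := hμ.isProbabilityMeasure
  cond_isProbabilityMeasure (hμ.exceed_pos m).ne'

lemma exceedanceLaw_apply (m : V) (S : Set (V → ℝ)) :
    exceedanceLaw μ m S = (μ {y | 1 < y m})⁻¹ * μ ({y | 1 < y m} ∩ S) :=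
  cond_apply (measurableSet_lt_apply m 1) μ S

/-- Homogeneity of the law of `Y^m`: restricted to `{Y_m > u}`, it is the law of `u Y^m` up to the
factor `u⁻¹`. -/
lemma IsMultivariatePareto.exceedanceLaw_restrict [Fintype V] (hμ : IsMultivariatePareto μ) (m : V) {u : ℝ}
    (hu : 1 ≤ u) :
    (exceedanceLaw μ m).restrict {y | u < y m} =
      (ENNReal.ofReal u)⁻¹ • (exceedanceLaw μ m).map (fun y => u • y) := by
  have hu0 : 0 < u := by linarith
  have hconull (S : Set (V → ℝ)) : μ (S ∩ paretoSupport V) = μ S :=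
    measure_inter_conull hμ.supported
  ext S hS
  have hmeas : Measurable fun y : V → ℝ => u • y := measurable_const_smul u
  rw [Measure.restrict_apply hS, Measure.smul_apply, Measure.map_apply hmeas hS,
    exceedanceLaw_apply, exceedanceLaw_apply, smul_eq_mul, mul_left_comm]
  congr 1
  -- Homogeneity is available only inside 𝓛. After dilation by u, the bound Y_m > u ≥ 1 supplies the
  -- large coordinate that 𝓛 requires.
  rw [← hconull ({y | 1 < y m} ∩ (fun y => u • y) ⁻¹' S),
    ← hμ.homogeneous u hu _ (((measurableSet_lt_apply m 1).inter (hmeas hS)).inter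
      measurableSet_paretoSupport) Set.inter_subset_right,
    ← hconull ({y | 1 < y m} ∩ (S ∩ {y | u < y m}))]
  congr 1
  ext y
  rw [Set.mem_smul_set_iff_inv_smul_mem₀ hu0.ne']
  simp only [paretoSupport, Set.mem_inter_iff, Set.mem_ofPred_eq, Pi.smul_apply, smul_eq_mul,
    Set.mem_preimage, smul_inv_smul₀ hu0.ne']
  have e1 : ∀ i, 0 ≤ u⁻¹ * y i ↔ 0 ≤ y i := fun i => mul_nonneg_iff_of_pos_left (by positivity)
  have e2 : ∀ i, 1 < u⁻¹ * y i ↔ u < y i := fun i => by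
    rw [inv_mul_eq_div, one_lt_div hu0]
  simp only [e1, e2]
  constructor
  · rintro ⟨⟨-, h1, h2⟩, h3, -⟩
    exact ⟨⟨h2, h1⟩, h3, m, h2⟩
  · rintro ⟨⟨h2, h1⟩, h3, -⟩
    exact ⟨⟨hu.trans_lt h2, h1, h2⟩, h3, m, hu.trans_lt h2⟩

/-! ### Independent increments -/

lemma measurable_log_sub_log (t s : V) :
    Measurable fun y : V → ℝ => Real.log (y t) - Real.log (y s) := by fun_prop

/-- If `Y^m_t` and `Y^m_C` are conditionally independent given `Y^m_s` and `m ∈ C ∪ {s}`, then the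
increment `log Y^m_t - log Y^m_s` is independent of `(Y^m_s, Y^m_C)`. -/
lemma IsMultivariatePareto.indepFun_log_sub_log [Fintype V] (hμ : IsMultivariatePareto μ) {m s t : V}
    {C : Set V} (hm : m = s ∨ m ∈ C)
    (hpos : ∀ᵐ y ∂(exceedanceLaw μ m), 0 < y t ∧ 0 < y s)
    (h : CondIndepFun (MeasurableSpace.comap (subvector {s}) inferInstance)
      (measurable_subvector {s}).comap_le (subvector {t}) (subvector C) (exceedanceLaw μ m)) :
    IndepFun (fun y : V → ℝ => Real.log (y t) - Real.log (y s))
      (fun y => (subvector {s} y, subvector C y)) (exceedanceLaw μ m) := by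
  have hprob := hμ.isProbabilityMeasure_exceedanceLaw m
  set ν := exceedanceLaw μ m with hν
  have hk := measurable_subvector (V := V) {s}
  have hg := measurable_subvector (V := V) C
  rw [indepFun_iff_measure_inter_preimage_eq_mul]
  intro B D hB hD
  have hS : MeasurableSet {q : (({s} : Set V) → ℝ) × (({t} : Set V) → ℝ) |
      Real.log (q.2 ⟨t, rfl⟩) - Real.log (q.1 ⟨s, rfl⟩) ∈ B} := by
    have : Measurable fun q : (({s} : Set V) → ℝ) × (({t} : Set V) → ℝ) =>
      Real.log (q.2 ⟨t, rfl⟩) - Real.log (q.1 ⟨s, rfl⟩) := by fun_prop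
    exact this hB
  obtain ⟨φ, hφ, hφE⟩ := CondIndepFun.exists_conditional_probability
    (measurable_subvector {t}) hg hk h hS
  set ψ : ℝ → ℝ≥0∞ := fun r => φ fun _ => r with hψdef
  have hψ : Measurable ψ := hφ.comp (measurable_pi_lambda _ fun _ => measurable_id)
  have hsub : ∀ y : V → ℝ, subvector {s} y = fun _ => y s := fun y => by
    ext ⟨a, ha⟩; obtain rfl : a = s := ha; rfl
  set X : (V → ℝ) → ℝ := fun y => Real.log (y t) - Real.log (y s)
  have hX : Measurable X := measurable_log_sub_log t s
  have hφE' : ∀ E : Set ((({s} : Set V) → ℝ) × (C → ℝ)), MeasurableSet E →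
      ν ({y | (subvector {s} y, subvector C y) ∈ E} ∩ X ⁻¹' B) =
        ∫⁻ y in {y | (subvector {s} y, subvector C y) ∈ E}, ψ (y s) ∂ν := by
    intro E hE
    refine (hφE E hE).trans (lintegral_congr fun y => ?_)
    rw [hsub]
  -- The events {Y_m > u} must be functions of (Y_s, Y_C); this is the role of m ∈ C ∪ {s}.
  have hevent : ∀ u : ℝ, ∃ E : Set ((({s} : Set V) → ℝ) × (C → ℝ)), MeasurableSet E ∧
      {y | (subvector {s} y, subvector C y) ∈ E} = {y : V → ℝ | u < y m} := by
    intro u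
    rcases hm with rfl | hm
    · exact ⟨{q | u < q.1 ⟨m, rfl⟩}, measurableSet_lt measurable_const (by fun_prop), rfl⟩
    · exact ⟨{q | u < q.2 ⟨m, hm⟩}, measurableSet_lt measurable_const (by fun_prop), rfl⟩
  have hs : Measurable fun y : V → ℝ => y s := measurable_pi_apply s
  have hinv : ∀ u : ℝ, 1 ≤ u → ∀ᵐ x ∂(ν.map fun y => y s), ψ (u * x) = ψ x := by
    intro u hu
    have hu0 : 0 < u := by linarith
    have hmeas : Measurable fun y : V → ℝ => u • y := measurable_const_smul u
    have hψu : Measurable fun x => ψ (u * x) := by fun_prop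
    refine ae_eq_of_forall_setLIntegral_eq_of_sigmaFinite hψu hψ fun D hD _ => ?_
    rw [setLIntegral_map hD hψu hs, setLIntegral_map hD hψ hs]
    obtain ⟨E, hE, hEm⟩ := hevent u
    have hDs : MeasurableSet ((fun y : V → ℝ => u⁻¹ * y s) ⁻¹' D) :=
      (by fun_prop : Measurable fun y : V → ℝ => u⁻¹ * y s) hD
    have hDs' : (fun y : V → ℝ => u • y) ⁻¹' ((fun y : V → ℝ => u⁻¹ * y s) ⁻¹' D) =
        (fun y => y s) ⁻¹' D := by
      ext y; simp [inv_mul_cancel_left₀ hu0.ne']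
    -- The event {u⁻¹ Y_s ∈ D, Y_m > u} rescales to {Y_s ∈ D}, and both sides acquire the same
    -- factor u⁻¹.
    have h1 := hφE' ({q | u⁻¹ * q.1 ⟨s, rfl⟩ ∈ D} ∩ E)
      (((by fun_prop : Measurable fun q : (({s} : Set V) → ℝ) × (C → ℝ) =>
        u⁻¹ * q.1 ⟨s, rfl⟩) hD).inter hE)
    have hset : {y | (subvector {s} y, subvector C y) ∈ {q | u⁻¹ * q.1 ⟨s, rfl⟩ ∈ D} ∩ E} =
        (fun y : V → ℝ => u⁻¹ * y s) ⁻¹' D ∩ {y | u < y m} := by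
      rw [← hEm]; rfl
    have h2 := hφE' {q | q.1 ⟨s, rfl⟩ ∈ D}
      ((by fun_prop : Measurable fun q : (({s} : Set V) → ℝ) × (C → ℝ) => q.1 ⟨s, rfl⟩) hD)
    have hset2 : {y | (subvector {s} y, subvector C y) ∈ {q | q.1 ⟨s, rfl⟩ ∈ D}} =
        (fun y : V → ℝ => y s) ⁻¹' D := rfl
    rw [hset2] at h2
    -- Scale invariance needs positive coordinates, because `Real.log 0 = 0`.
    have hXu : (fun y : V → ℝ => u • y) ⁻¹' (X ⁻¹' B) =ᵐ[ν] X ⁻¹' B := by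
      filter_upwards [hpos] with y hy
      have : X (u • y) = X y := by
        simp only [X, Pi.smul_apply, smul_eq_mul, Real.log_mul hu0.ne' hy.1.ne',
          Real.log_mul hu0.ne' hy.2.ne']
        ring
      exact propext (by change X (u • y) ∈ B ↔ X y ∈ B; rw [this])
    rw [hset, Set.inter_right_comm, ← Measure.restrict_apply (hDs.inter (hX hB)),
      ← Measure.restrict_restrict hDs, hμ.exceedanceLaw_restrict m hu, ← hν, Measure.smul_apply,
      Measure.map_apply hmeas (hDs.inter (hX hB)), Measure.restrict_smul, lintegral_smul_measure,
      setLIntegral_map hDs (by fun_prop) hmeas, Set.preimage_inter, hDs',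
      measure_congr ((ae_eq_refl _).inter hXu), h2, smul_eq_mul, smul_eq_mul] at h1
    exact ((ENNReal.mul_right_inj (ENNReal.inv_ne_zero.2 ENNReal.ofReal_ne_top)
      (ENNReal.inv_ne_top.2 (by simpa using hu0))).1 h1).symm
  obtain ⟨c, hc⟩ := exists_ae_eq_const_of_ae_dilation_invariant
    ((ae_map_iff hs.aemeasurable measurableSet_Ioi).2 (hpos.mono fun y hy => hy.2)) hψ hinv
  have hc' : ∀ᵐ y ∂ν, ψ (y s) = c := ae_of_ae_map hs.aemeasurable hc
  have hconst : ∀ E : Set ((({s} : Set V) → ℝ) × (C → ℝ)), MeasurableSet E →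
      ν ({y | (subvector {s} y, subvector C y) ∈ E} ∩ X ⁻¹' B) =
        c * ν {y | (subvector {s} y, subvector C y) ∈ E} := by
    intro E hE
    rw [hφE' E hE, lintegral_congr_ae (ae_restrict_of_ae hc'), setLIntegral_const]
  have htotal : ν (X ⁻¹' B) = c := by
    simpa using hconst Set.univ MeasurableSet.univ
  rw [Set.inter_comm, htotal]
  exact hconst D hD

/-! ### Separating vertices in graphs and trees -/

/-- Every walk from `a` to `b` that is a path passes through `k`. -/
def SimpleGraph.PathsMeet (G : SimpleGraph V) (k a b : V) : Prop :=
  ∀ p : G.Walk a b, p.IsPath → k ∈ p.support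

namespace SimpleGraph

variable {G : SimpleGraph V}

lemma PathsMeet.mem_support {k a b : V} (h : G.PathsMeet k a b) (p : G.Walk a b) :
    k ∈ p.support := by
  classical
  exact p.support_bypass_subset_support (h p.bypass p.bypass_isPath)

lemma PathsMeet.symm {k a b : V} (h : G.PathsMeet k a b) : G.PathsMeet k b a :=
  fun p hp => by simpa using h p.reverse hp.reverse

lemma PathsMeet.right (a b : V) : G.PathsMeet b a b := fun p _ => p.end_mem_support

/-- A vertex between `i` and `j` is between `i` and `m` or between `j` and `m`. -/
lemma PathsMeet.or {k i j : V} (h : G.PathsMeet k i j) (m : V) :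
    G.PathsMeet k i m ∨ G.PathsMeet k j m := by
  by_contra! hcon
  simp only [PathsMeet, not_forall] at hcon
  obtain ⟨⟨p, -, hp⟩, q, -, hq⟩ := hcon
  have := h.mem_support (p.append q.reverse)
  simp [Walk.mem_support_append_iff, hp, hq] at this

lemma IsTree.pathsMeet_of_mem_support (hG : G.IsTree) {k a b : V} {p : G.Walk a b}
    (hp : p.IsPath) (hk : k ∈ p.support) : G.PathsMeet k a b := fun q hq => by
  rwa [(hG.existsUnique_path a b).unique hq hp]

lemma IsTree.length_eq_dist (hG : G.IsTree) {a b : V} {p : G.Walk a b} (hp : p.IsPath) :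
    p.length = G.dist a b := by
  obtain ⟨q, hq, hlen⟩ := (hG.connected a b).exists_path_of_dist
  rw [(hG.existsUnique_path a b).unique hp hq, hlen]

/-- A path from t to m avoiding s would extend by the edge to a path from s to m, making s farther
from m than t. -/
lemma IsTree.pathsMeet_of_dist_eq_add_one (hG : G.IsTree) {m s t : V} (hst : G.Adj s t)
    (hd : G.dist m t = G.dist m s + 1) : G.PathsMeet s t m := by
  intro p hp
  by_contra hs
  have h1 := hG.length_eq_dist (hp.cons hs (h := hst))
  have h2 := hG.length_eq_dist hp
  rw [Walk.length_cons, h2, G.dist_comm (u := t), G.dist_comm (u := s)] at h1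
  omega

end SimpleGraph

/-! ### Additivity along paths -/

lemma ExtremalVariogramExists.ae_pos {m : V} (h : ExtremalVariogramExists μ m) (i : V) :
    ∀ᵐ y ∂(exceedanceLaw μ m), 0 < y i := (h i i).1.mono fun _ hy => hy.1

/-- In an extremal graphical model, the increment `log Y^m_t - log Y^m_s` is independent of
`(Y^m_s, Y^m_a)` if `s` lies between `t` and each of `a` and the root `m`. -/
lemma IsExtremalGraphicalModel.indepFun_log_sub_log [Fintype V] {G : SimpleGraph V}
    (hμ : IsExtremalGraphicalModel μ G) {m s t a : V} (hΓ : ExtremalVariogramExists μ m)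
    (hts : t ≠ s) (ha : G.PathsMeet s t a) (hm : G.PathsMeet s t m) :
    IndepFun (fun y : V → ℝ => Real.log (y t) - Real.log (y s)) (fun y => (y s, y a))
      (exceedanceLaw μ m) := by
  -- Removing s keeps C disjoint from the separator; when a or m equals s, its value is recovered
  -- from Y_s.
  set C : Set V := {a, m} \ {s} with hC
  have hsep : ∀ c ∈ C, G.PathsMeet s t c := by
    rintro c ⟨rfl | rfl, -⟩ <;> assumption
  have htC : t ∉ C := fun h => hts (by simpa [eq_comm] using hsep t h .nil .nil)
  have hci := hμ.globalMarkov {t} {s} C (by simpa using hts) (by simpa using htC)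
    (Set.disjoint_sdiff_right) (by
      rintro _ rfl c hc p hp
      exact ⟨s, hsep c hc p hp, rfl⟩) m
  have hmC : m = s ∨ m ∈ C := by
    by_cases h : m = s
    · exact .inl h
    · exact .inr ⟨.inr rfl, h⟩
  have hind := hμ.isMultivariatePareto.indepFun_log_sub_log hmC (hΓ t s).1 hci
  have haC : a = s ∨ a ∈ C := by
    by_cases h : a = s
    · exact .inl h
    · exact .inr ⟨.inl rfl, h⟩
  rcases haC with rfl | haC
  · exact hind.comp (φ := id) measurable_id
      (by fun_prop : Measurable fun q : (({a} : Set V) → ℝ) × (C → ℝ) =>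
        (q.1 ⟨a, rfl⟩, q.1 ⟨a, rfl⟩))
  · exact hind.comp (φ := id) measurable_id
      (by fun_prop : Measurable fun q : (({s} : Set V) → ℝ) × (C → ℝ) =>
        (q.1 ⟨s, rfl⟩, q.2 ⟨a, haC⟩))

lemma extremalVariogram_self (m i : V) : extremalVariogram μ m i i = 0 := by
  simp only [extremalVariogram, sub_self]
  exact variance_zero _

lemma extremalVariogram_comm (m i j : V) :
    extremalVariogram μ m i j = extremalVariogram μ m j i := by
  rw [extremalVariogram, extremalVariogram, ← variance_fun_neg]
  simp

/-- Since k also separates j from the root, the increment from k to j is independent of (Y_k, Y_i),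
hence of the increment from i to k. -/
lemma IsExtremalGraphicalModel.extremalVariogram_add_of_pathsMeet_root [Fintype V] {G : SimpleGraph V}
    (hμ : IsExtremalGraphicalModel μ G) {m i k j : V} (hΓ : ExtremalVariogramExists μ m)
    (hi : G.PathsMeet k j i) (hm : G.PathsMeet k j m) :
    extremalVariogram μ m j i = extremalVariogram μ m j k + extremalVariogram μ m k i := by
  rcases eq_or_ne j k with rfl | hjk
  · rw [extremalVariogram_self, zero_add]
  have hind := (hμ.indepFun_log_sub_log hΓ hjk hi hm).comp (φ := id)
    (ψ := fun q : ℝ × ℝ => Real.log q.1 - Real.log q.2) measurable_id (by fun_prop)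
  have hvar := hind.variance_add (hΓ j k).2 (hΓ k i).2
  rw [extremalVariogram, extremalVariogram, extremalVariogram]
  refine Eq.trans ?_ hvar
  congr 1
  ext y
  simp

/-- By `PathsMeet.or`, k separates i or j from the root; symmetry of the variogram reduces both
cases to the previous lemma. -/
lemma IsExtremalGraphicalModel.extremalVariogram_add [Fintype V] {G : SimpleGraph V}
    (hμ : IsExtremalGraphicalModel μ G) {m i k j : V} (hΓ : ExtremalVariogramExists μ m)
    (h : G.PathsMeet k i j) :
    extremalVariogram μ m i j = extremalVariogram μ m i k + extremalVariogram μ m k j := by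
  rcases h.or m with hm | hm
  · exact hμ.extremalVariogram_add_of_pathsMeet_root hΓ h hm
  · rw [extremalVariogram_comm m i j, extremalVariogram_comm m i k, extremalVariogram_comm m k j,
      add_comm]
    exact hμ.extremalVariogram_add_of_pathsMeet_root hΓ h.symm hm

lemma IsExtremalGraphicalModel.extremalVariogram_eq_sum_darts [Fintype V] {G : SimpleGraph V}
    (hG : G.IsTree) (hμ : IsExtremalGraphicalModel μ G) {m : V}
    (hΓ : ExtremalVariogramExists μ m) {i j : V} (p : G.Walk i j) (hp : p.IsPath) :
    extremalVariogram μ m i j =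
      (p.darts.map fun e => extremalVariogram μ m e.fst e.snd).sum := by
  induction p with
  | nil => simp [extremalVariogram_self]
  | @cons _ k _ h q ih =>
    rw [hμ.extremalVariogram_add hΓ (hG.pathsMeet_of_mem_support hp (by simp :
      k ∈ (SimpleGraph.Walk.cons h q).support)), ih hp.of_cons]
    simp

lemma IsExtremalGraphicalModel.isAdditiveTreeMetric [Fintype V] {G : SimpleGraph V}
    (hG : G.IsTree) (hμ : IsExtremalGraphicalModel μ G) {m : V}
    (hΓ : ExtremalVariogramExists μ m) : IsAdditiveTreeMetric G (extremalVariogram μ m) where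
  nonneg _ _ := variance_nonneg _ _
  self := extremalVariogram_self m
  symm := extremalVariogram_comm m
  triangle i j k := by
    classical
    obtain ⟨p, hp⟩ := (hG.connected i j).exists_isPath
    obtain ⟨q, hq⟩ := (hG.connected j k).exists_isPath
    rw [hμ.extremalVariogram_eq_sum_darts hG hΓ p hp,
      hμ.extremalVariogram_eq_sum_darts hG hΓ q hq,
      hμ.extremalVariogram_eq_sum_darts hG hΓ (p.append q).bypass (p.append q).bypass_isPath,
      ← List.sum_append, ← List.map_append, ← SimpleGraph.Walk.darts_append]
    -- The path from i to k uses only some darts of the concatenated walk, and the omitted weights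
    -- are non-negative.
    refine ((p.append q).darts_bypass_sublist_darts.map _).sum_le_sum fun x hx => ?_
    obtain ⟨e, -, rfl⟩ := List.mem_map.1 hx
    exact variance_nonneg _ _
  additive _ _ p hp := hμ.extremalVariogram_eq_sum_darts hG hΓ p hp

/-! ### Change of root -/

/-- If Y^m_s ≤ 1 almost surely, homogeneity improves this to Y^m_s ≤ 1/(n+1) for every n,
contradicting positivity. -/
lemma IsMultivariatePareto.measure_exceed_inter_pos [Fintype V] (hμ : IsMultivariatePareto μ) {m s : V}
    (hpos : ∀ᵐ y ∂(exceedanceLaw μ m), 0 < y s) : μ ({y | 1 < y m} ∩ {y | 1 < y s}) ≠ 0 := by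
  have hprob := hμ.isProbabilityMeasure_exceedanceLaw m
  intro h0
  have h1 : exceedanceLaw μ m {y | 1 < y s} = 0 := by rw [exceedanceLaw_apply, h0, mul_zero]
  have h2 : ∀ n : ℕ, ∀ᵐ y ∂(exceedanceLaw μ m), ¬ 1 < ((n : ℝ) + 1) * y s := by
    intro n
    have hn : (1 : ℝ) ≤ n + 1 := by simp
    have hr := congrArg (fun ρ => ρ {y : V → ℝ | 1 < y s}) (hμ.exceedanceLaw_restrict m hn)
    rw [Measure.smul_apply, Measure.map_apply (measurable_const_smul _)
      (measurableSet_lt_apply s 1), smul_eq_mul,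
      Measure.restrict_apply (measurableSet_lt_apply s 1),
      measure_mono_null Set.inter_subset_left h1, eq_comm, mul_eq_zero,
      or_iff_right (ENNReal.inv_ne_zero.2 ENNReal.ofReal_ne_top)] at hr
    exact measure_eq_zero_iff_ae_notMem.1 hr
  rw [← ae_all_iff] at h2
  obtain ⟨y, hy, hy0⟩ := (h2.and hpos).exists
  obtain ⟨n, hn⟩ := exists_nat_gt (y s)⁻¹
  refine hy n ?_
  rw [← inv_lt_iff_one_lt_mul₀ hy0]
  linarith

/-- The law of `log Y^m_t - log Y^m_s` is the same under the roots `m` and `s` if `s` lies between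
`t` and `m`. -/
lemma IsExtremalGraphicalModel.map_log_sub_log_eq [Fintype V] {G : SimpleGraph V}
    (hμ : IsExtremalGraphicalModel μ G) (hΓ : ∀ m : V, ExtremalVariogramExists μ m) {m s t : V}
    (hts : t ≠ s) (hm : G.PathsMeet s t m) :
    (exceedanceLaw μ m).map (fun y => Real.log (y t) - Real.log (y s)) =
      (exceedanceLaw μ s).map (fun y => Real.log (y t) - Real.log (y s)) := by
  have hP := hμ.isMultivariatePareto
  have := hP.isProbabilityMeasure
  -- Under the root r the increment is independent of {Y_a > 1}. Taking (r, a) to be (m, s) and (s,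
  -- m) gives two factorizations of one μ-mass.
  have key : ∀ r a : V, G.PathsMeet s t r → G.PathsMeet s t a → ∀ B : Set ℝ, MeasurableSet B →
      μ (({y | 1 < y r} ∩ {y | 1 < y a}) ∩
        (fun y => Real.log (y t) - Real.log (y s)) ⁻¹' B) =
      exceedanceLaw μ r ((fun y => Real.log (y t) - Real.log (y s)) ⁻¹' B) *
        μ ({y | 1 < y r} ∩ {y | 1 < y a}) := by
    intro r a hr ha B hB
    have h := (hμ.indepFun_log_sub_log (hΓ r) hts ha hr).measure_inter_preimage_eq_mul B
      {q | 1 < q.2} hB (measurableSet_lt measurable_const measurable_snd)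
    have e : (fun y : V → ℝ => (y s, y a)) ⁻¹' {q | 1 < q.2} = {y | 1 < y a} := rfl
    rw [e, Set.inter_comm, exceedanceLaw_apply r (_ ∩ _), exceedanceLaw_apply r {y | 1 < y a},
      mul_left_comm, ← Set.inter_assoc] at h
    exact (ENNReal.mul_right_inj (ENNReal.inv_ne_zero.2 (measure_ne_top _ _))
      (ENNReal.inv_ne_top.2 (hP.exceed_pos r).ne')).1 h
  ext B hB
  rw [Measure.map_apply (measurable_log_sub_log t s) hB,
    Measure.map_apply (measurable_log_sub_log t s) hB]
  have h1 := key m s hm (.right t s) B hB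
  rw [Set.inter_comm {y : V → ℝ | 1 < y m}, key s m (.right t s) hm B hB] at h1
  refine ((ENNReal.mul_left_inj ?_ (measure_ne_top _ _)).1 h1).symm
  rw [Set.inter_comm]
  exact hP.measure_exceed_inter_pos ((hΓ m).ae_pos s)

/-- For an extremal graphical model on a tree `T` whose extremal variograms exist, every `Γ^{(m)}`
is an additive tree metric on `T`, and `Γ^{(m)}_{st} = Γ^{(s)}_{st}` for every edge `(s, t)` of `T`
that points away from the root `m`. -/
theorem mainTheorem6 {V : Type*} [Fintype V] (T : SimpleGraph V) (hT : T.IsTree)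
    (μ : MeasureTheory.Measure (V → ℝ)) (hμ : IsExtremalGraphicalModel μ T)
    (hΓ : ∀ m : V, ExtremalVariogramExists μ m) :
    (∀ m : V, IsAdditiveTreeMetric T (extremalVariogram μ m)) ∧
    (∀ m s t : V, T.Adj s t → T.dist m t = T.dist m s + 1 →
      extremalVariogram μ m s t = extremalVariogram μ s s t) := by
  refine ⟨fun m => hμ.isAdditiveTreeMetric hT (hΓ m), fun m s t hst hd => ?_⟩
  rw [extremalVariogram_comm m, extremalVariogram_comm s, extremalVariogram, extremalVariogram]
  exact (IdentDistrib.mk (measurable_log_sub_log t s).aemeasurable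
    (measurable_log_sub_log t s).aemeasurable (hμ.map_log_sub_log_eq hΓ hst.ne'
      (hT.pathsMeet_of_dist_eq_add_one hst hd))).variance_eq
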